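/- A Lie ring $R$ is called a UA-Lie ring (unique addition Lie ring) if for every Lie ring $S$, every bijection $\alpha\colon R\to S$ satisfying $\alpha([a,b])=[\alpha(a),\alpha(b)]$ for all $a,b\in R$ is additive, i.e. satisfies $\alpha(a+b)=\alpha(a)+\alpha(b)$ for all $a,b\in R$. Theorem. Let $K$ be an algebraically closed field of characteristic zero, let $\mathfrak{g}$ be a finite-dimensional semisimple Lie algebra over $K$, and let $\mathfrak{p}$ be a parabolic subalgebra of $\mathfrak{g}$, i.e. a Lie subalgebra containing a Borel (maximal solvable) subalgebra of $\mathfrak{g}$. Then both $\mathfrak{g}$ and $\mathfrak{p}$, regarded as Lie rings, are UA-Lie rings. -/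

import Mathlib

universe u v w

/-- A Lie ring `R` is a *unique addition Lie ring* (UA-Lie ring) if every commutator-preserving
bijection from `R` onto an arbitrary Lie ring `S` is additive. The universe of `S` is arbitrary. -/
def IsUALieRing (R : Type u) [LieRing R] : Prop :=
  ∀ (S : Type w) [LieRing S] (α : R → S), Function.Bijective α →
    (∀ a b : R, α ⁅a, b⁆ = ⁅α a, α b⁆) → ∀ a b : R, α (a + b) = α a + α b

/-- A *Borel subalgebra* is a subalgebra that is maximal (for inclusion) among all solvable
subalgebras. (Used for finite-dimensional Lie algebras over an algebraically closed field of
characteristic zero.) -/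
def LieSubalgebra.IsBorel {K : Type u} {L : Type v} [Field K] [LieRing L] [LieAlgebra K L]
    (b : LieSubalgebra K L) : Prop :=
  Maximal (fun c : LieSubalgebra K L => LieAlgebra.IsSolvable c) b

/-- A *parabolic subalgebra* is a subalgebra that contains a Borel subalgebra. -/
def LieSubalgebra.IsParabolic {K : Type u} {L : Type v} [Field K] [LieRing L] [LieAlgebra K L]
    (p : LieSubalgebra K L) : Prop :=
  ∃ b : LieSubalgebra K L, b.IsBorel ∧ b ≤ p

/-!
A second Lie ring structure with the same bracket can be compared with the given one by brackets
alone: `α z = α x + α y` implies `α ⁅r, z⁆ = α ⁅r, x⁆ + α ⁅r, y⁆`. For a Lie algebra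
`R = H ⊕ ⨁ K • e i` with a toral part `H` acting on the lines `K • e i` through weights, this is
enough to force additivity of `α` (`RootDecomposition.additive_of_map_lie`).

* On one line `K • e i`: if `h ∈ H` has weight `1` on `e i`, then `α h + α (t • e i)` is the image
  of `t • e i + k` for some `k ∈ H`, again of weight `1`. The bracket of two such elements, computed
  in both structures, shows that `α` is additive on the line.
* On `H`: bracket with all the `e i` and use that the weights separate the points of `H`.
* For the coordinate of a general element along `e i`: a composition of operators `⁅h, ·⁆` kills all
  weight lines but those of weights `±β i`, and, if `-β i` occurs, a bracket with its root vector
  maps the coordinate into `H`. So the coordinates are additive, and `α⁻¹ (α x + α y) - (x + y)`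
  lies in `H`. Bracketing with `e i` turns this defect into a coordinate, so it has weight `0` for
  every `i` and vanishes.

It remains to find a root decomposition of a parabolic subalgebra `p`. If `p` contains a Cartan
subalgebra `H` of `g`, then `p` is the sum of `H` and root spaces. So the point is that a Borel
subalgebra `b`, which is only assumed to be maximal solvable, contains a Cartan subalgebra of `g`.
Conjugacy of Borel subalgebras is not needed; the Killing form suffices.

* The orthogonal complement of `b` is contained in `b`, by Lie's theorem and Cartan's criterion
  (`LieSubalgebra.IsBorel.mem_of_killingForm_eq_zero`), and it consists of nilpotent elements, since
  `b` contains the replicas of its elements (`LieSubalgebra.IsBorel.isNilpotent_ad`).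
* If a Cartan subalgebra `C` of `b` is the Engel subalgebra of `a ∈ b` and `G` is the Engel
  subalgebra of `a` in `g`, then the orthogonal complement of `C` in `G` lies in `C`, and it must
  vanish: a nonzero element `x` of it that is central in `C` would satisfy `⁅x, ⁅x, G⁆⁆ = 0`
  with `x` and `⁅x, G⁆` nilpotent, hence be orthogonal to `G`
  (`isNilpotent_mul_of_commute_commutator`). Therefore `G = C`, which is a Cartan subalgebra of `g`
  (`LieSubalgebra.IsBorel.exists_isCartanSubalgebra_le`).

The inclusion of the orthogonal complement of `b` in `b` also shows that the roots of `p` separate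
the points of `H`. The algebra `g` itself is parabolic.
-/

/-! ### Lie algebras with a root decomposition have unique addition -/

/-- A root decomposition of a Lie algebra `R`: a direct sum decomposition of `R` into a toral part
`H` and lines `K • e i` on which `H` acts through weights `β i`. The projection onto the line
`K • e i` is recorded by the coordinate `c i`; only the values of `β i` on `H` matter. The weights
are nonzero on `H`, they jointly separate the points of `H`, and by `isolate` each
`β i` is linearly independent of every other weight except possibly one `β j`, in which case the
bracket of `e j` and `e i` is a nonzero element of `H`. In a root system, `β j = -β i`. -/
structure RootDecomposition (K R ι : Type*) [Field K] [LieRing R] [LieAlgebra K R] [Fintype ι] where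
  H : Submodule K R
  e : ι → R
  c : ι → R →ₗ[K] K
  β : ι → R →ₗ[K] K
  lie_H : ∀ h ∈ H, ∀ h' ∈ H, ⁅h, h'⁆ = 0
  lie_e : ∀ h ∈ H, ∀ i, ⁅h, e i⁆ = β i h • e i
  c_self : ∀ i, c i (e i) = 1
  c_ne : ∀ i j, i ≠ j → c i (e j) = 0
  c_H : ∀ i, ∀ h ∈ H, c i h = 0
  sub_sum_mem : ∀ r, r - ∑ i, c i r • e i ∈ H
  separating : ∀ h ∈ H, (∀ i, β i h = 0) → h = 0
  exists_one : ∀ i, ∃ h ∈ H, β i h = 1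
  isolate : ∀ i, ∃ j, (j = i ∨ (⁅e j, e i⁆ ≠ 0 ∧ ⁅e j, e i⁆ ∈ H)) ∧
    ∀ k, k ≠ i → k ≠ j → ∃ h ∈ H, β i h = 1 ∧ β k h = 0

namespace RootDecomposition

variable {K R ι : Type*} [Field K] [LieRing R] [LieAlgebra K R] [Fintype ι]

section Coordinates

variable (D : RootDecomposition K R ι)

lemma mem_of_c_eq_zero {r : R} (hr : ∀ i, D.c i r = 0) : r ∈ D.H := by
  simpa [hr] using D.sub_sum_mem r

lemma c_lie {h : R} (hh : h ∈ D.H) (i : ι) (r : R) : D.c i ⁅h, r⁆ = D.β i h * D.c i r := by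
  classical
  have h1 : ⁅h, r⁆ = ∑ j, (D.c j r * D.β j h) • D.e j := by
    conv_lhs => rw [← sub_add_cancel r (∑ j, D.c j r • D.e j)]
    rw [lie_add, D.lie_H h hh _ (D.sub_sum_mem r), zero_add, lie_sum]
    simp [lie_smul, D.lie_e h hh, smul_smul]
  rw [h1, map_sum, Finset.sum_eq_single i]
  · simp [D.c_self, mul_comm]
  · intro j _ hj
    simp [D.c_ne i j hj.symm]
  · simp

lemma mem_of_lie_eq_zero {r : R} (hr : ∀ h ∈ D.H, ⁅h, r⁆ = 0) : r ∈ D.H := by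
  refine D.mem_of_c_eq_zero fun i ↦ ?_
  obtain ⟨h, hh, h1⟩ := D.exists_one i
  simpa [hr h hh, h1] using (D.c_lie hh i r).symm

lemma e_lie {h : R} (hh : h ∈ D.H) (i : ι) : ⁅D.e i, h⁆ = -(D.β i h • D.e i) := by
  rw [← lie_skew, D.lie_e h hh]

lemma eq_of_smul_e_eq {i : ι} {s t : K} (h : s • D.e i = t • D.e i) : s = t := by
  simpa [D.c_self] using congrArg (D.c i) h

end Coordinates

variable {S : Type*} [LieRing S] {α : R → S}

/-- The endomorphisms of `R` that are additive for the addition transported from `S` along `α`.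
They contain all compositions of operators `⁅r, ·⁆`. -/
def additiveOperators (K : Type*) [Field K] [LieAlgebra K R] (α : R → S) :
    Submonoid (Module.End K R) where
  carrier := {φ | ∀ x y z, α z = α x + α y → α (φ z) = α (φ x) + α (φ y)}
  one_mem' := fun _ _ _ h ↦ h
  mul_mem' := fun h₁ h₂ x y z h ↦ h₁ _ _ _ (h₂ x y z h)

lemma ad_mem_additiveOperators (hα : ∀ a b : R, α ⁅a, b⁆ = ⁅α a, α b⁆) (r : R) :
    LieAlgebra.ad K R r ∈ additiveOperators K α := by
  intro x y z h
  simp only [LieAlgebra.ad_apply, hα, h, lie_add]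

variable (D : RootDecomposition K R ι)

section Operators

variable (hα : ∀ a b : R, α ⁅a, b⁆ = ⁅α a, α b⁆)
include hα

/-- For a finite set of weights each of which vanishes at a point where `β i` does not, the product
of the operators `⁅h, ·⁆` at these points, times one more, fixes `e i` and kills `H` and the chosen
weight lines. -/
lemma exists_additiveOperator (i : ι) (s : Finset ι)
    (hs : ∀ k ∈ s, ∃ h ∈ D.H, D.β i h = 1 ∧ D.β k h = 0) :
    ∃ φ ∈ additiveOperators K α, ∃ a : ι → K, a i = 1 ∧ (∀ k ∈ s, a k = 0) ∧
      (∀ k, φ (D.e k) = a k • D.e k) ∧ ∀ h ∈ D.H, φ h = 0 := by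
  classical
  induction s using Finset.induction_on with
  | empty =>
    obtain ⟨h, hh, h1⟩ := D.exists_one i
    refine ⟨LieAlgebra.ad K R h, ad_mem_additiveOperators hα h, fun k ↦ D.β k h, h1, by simp,
      fun k ↦ ?_, fun h' hh' ↦ ?_⟩
    · simp [D.lie_e h hh]
    · simp [D.lie_H h hh h' hh']
  | insert k s _ ih =>
    obtain ⟨φ, hφ, a, hai, has, hφe, hφH⟩ := ih fun k hk ↦ hs k (Finset.mem_insert_of_mem hk)
    obtain ⟨h, hh, h1, h0⟩ := hs k (Finset.mem_insert_self k s)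
    refine ⟨φ * LieAlgebra.ad K R h, mul_mem hφ (ad_mem_additiveOperators hα h),
      fun j ↦ D.β j h * a j, by simp [h1, hai], ?_, fun j ↦ ?_, fun h' hh' ↦ ?_⟩
    · intro j hj
      rcases Finset.mem_insert.mp hj with rfl | hj
      · simp [h0]
      · simp [has j hj]
    · simp [D.lie_e h hh, hφe, smul_smul]
    · simp [D.lie_H h hh h' hh']

/-- Isolating the coordinate `c i` by an additive operator. If the weight opposite to `β i` occurs,
bracketing with its root vector moves the coordinate into `H`. -/
lemma exists_isolating_operator (i : ι) :
    ∃ φ ∈ additiveOperators K α, ∃ u : R, u ≠ 0 ∧ (u ∈ D.H ∨ u = D.e i) ∧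
      ∀ r, φ r = D.c i r • u := by
  classical
  obtain ⟨j, hj, hk⟩ := D.isolate i
  obtain ⟨φ, hφ, a, hai, has, hφe, hφH⟩ := D.exists_additiveOperator hα i
    (Finset.univ.filter fun k ↦ k ≠ i ∧ k ≠ j) (by simpa using hk)
  have hφr (r : R) : φ r = ∑ k, (D.c k r * a k) • D.e k := by
    conv_lhs => rw [← sub_add_cancel r (∑ k, D.c k r • D.e k)]
    rw [map_add, hφH _ (D.sub_sum_mem r), zero_add, map_sum]
    simp [hφe, smul_smul]
  have ha (k : ι) (h1 : k ≠ i) (h2 : k ≠ j) : a k = 0 := has k (by simp [h1, h2])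
  have he : D.e i ≠ 0 := fun h ↦ by simpa [h] using D.c_self i
  by_cases hji : j = i
  · subst hji
    refine ⟨φ, hφ, D.e j, he, Or.inr rfl, fun r ↦ ?_⟩
    rw [hφr, Finset.sum_eq_single j]
    · simp [hai]
    · intro k _ h
      simp [ha k h h]
    · simp
  · obtain ⟨hu, huH⟩ := hj.resolve_left hji
    refine ⟨LieAlgebra.ad K R (D.e j) * φ, mul_mem (ad_mem_additiveOperators hα _) hφ,
      ⁅D.e j, D.e i⁆, hu, Or.inl huH, fun r ↦ ?_⟩
    rw [Module.End.mul_apply, hφr, map_sum, Finset.sum_eq_single i]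
    · simp [hai]
    · intro k _ h
      by_cases hkj : k = j
      · simp [hkj]
      · simp [ha k h hkj]
    · simp

end Operators

section Additivity

variable (hb : Function.Bijective α) (hα : ∀ a b : R, α ⁅a, b⁆ = ⁅α a, α b⁆)

include hα in
lemma map_zero_of_map_lie : α 0 = 0 := by
  have := hα 0 0
  rwa [lie_self, lie_self] at this

include hα in
lemma map_lie_of_map_eq_add {x y z : R} (h : α z = α x + α y) (r : R) :
    α ⁅r, z⁆ = α ⁅r, x⁆ + α ⁅r, y⁆ := by
  simp only [hα, h, lie_add]

include hb hα

/-- An element `h` of `H` with `β i h = 1` and a multiple of `e i` add up in `S` to the image of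
that multiple plus some `k ∈ H` with `β i k = 1`. -/
lemma exists_map_add_smul_e {i : ι} {h : R} (hh : h ∈ D.H) (h1 : D.β i h = 1) (t : K) :
    ∃ k ∈ D.H, D.β i k = 1 ∧ α (t • D.e i + k) = α h + α (t • D.e i) := by
  obtain ⟨z, hz⟩ := hb.2 (α h + α (t • D.e i))
  have hk : z - t • D.e i ∈ D.H := by
    refine D.mem_of_lie_eq_zero fun h' hh' ↦ ?_
    have h2 := map_lie_of_map_eq_add hα hz h'
    rw [D.lie_H h' hh' h hh, map_zero_of_map_lie hα, zero_add] at h2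
    rw [lie_sub, hb.1 h2, sub_self]
  refine ⟨_, hk, ?_, by simpa using hz⟩
  have h2 := map_lie_of_map_eq_add hα hz (D.e i)
  rw [lie_smul, lie_self, smul_zero, map_zero_of_map_lie hα, add_zero] at h2
  have h3 : ⁅D.e i, z - t • D.e i⁆ = ⁅D.e i, h⁆ := by
    rw [lie_sub, lie_smul, lie_self, smul_zero, sub_zero, hb.1 h2]
  rw [D.e_lie hk, D.e_lie hh, neg_inj] at h3
  rw [D.eq_of_smul_e_eq h3, h1]

lemma map_add_smul_e (i : ι) (s t : K) :
    α ((s + t) • D.e i) = α (s • D.e i) + α (t • D.e i) := by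
  obtain ⟨h, hh, h1⟩ := D.exists_one i
  obtain ⟨k, hk, hk1, hkα⟩ := D.exists_map_add_smul_e hb hα hh h1 (-t)
  obtain ⟨l, hl, hl1, hlα⟩ := D.exists_map_add_smul_e hb hα hh h1 s
  -- The bracket of `-t • e i + k` and `s • e i + l`, computed in `R` and in `S`.
  have hR : ⁅(-t) • D.e i + k, s • D.e i + l⁆ = (s + t) • D.e i := by
    simp only [add_lie, lie_add, smul_lie, lie_smul, lie_self, smul_zero, D.e_lie hl, D.lie_e k hk,
      D.lie_H k hk l hl, hl1, hk1]
    module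
  have h2 : ⁅α h, α (s • D.e i)⁆ = α (s • D.e i) := by
    rw [← hα, lie_smul, D.lie_e h hh, h1, one_smul]
  have h3 : ⁅α ((-t) • D.e i), α h⁆ = α (t • D.e i) := by
    rw [← hα, smul_lie, D.e_lie hh, h1, one_smul, neg_smul, smul_neg, neg_neg]
  have h4 : ⁅α ((-t) • D.e i), α (s • D.e i)⁆ = 0 := by
    rw [← hα, smul_lie, lie_smul, lie_self, smul_zero, smul_zero, map_zero_of_map_lie hα]
  rw [← hR, hα, hkα, hlα, add_lie, lie_add, lie_add, lie_self, h2, h3, h4]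
  abel

lemma map_add_H {h h' : R} (hh : h ∈ D.H) (hh' : h' ∈ D.H) : α (h + h') = α h + α h' := by
  obtain ⟨z, hz⟩ := hb.2 (α h + α h')
  have hzH : z ∈ D.H := by
    refine D.mem_of_lie_eq_zero fun k hk ↦ ?_
    have h2 := map_lie_of_map_eq_add hα hz k
    rw [D.lie_H k hk h hh, D.lie_H k hk h' hh', map_zero_of_map_lie hα, add_zero,
      ← map_zero_of_map_lie hα] at h2
    exact hb.1 h2
  suffices z - (h + h') = 0 by rw [← sub_eq_zero.mp this, hz]
  refine D.separating _ (sub_mem hzH (add_mem hh hh')) fun i ↦ ?_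
  have h2 := map_lie_of_map_eq_add hα hz (D.e i)
  rw [D.e_lie hzH, D.e_lie hh, D.e_lie hh', ← neg_smul, ← neg_smul, ← neg_smul,
    ← D.map_add_smul_e hb hα] at h2
  have h3 := D.eq_of_smul_e_eq (hb.1 h2)
  rw [map_sub, map_add]
  linear_combination -h3

lemma c_of_map_eq_add {x y z : R} (hz : α z = α x + α y) (i : ι) :
    D.c i z = D.c i x + D.c i y := by
  obtain ⟨φ, hφ, u, hu0, hu, hφr⟩ := D.exists_isolating_operator hα i
  have h1 := hφ x y z hz
  rw [hφr, hφr, hφr] at h1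
  have h2 : α (D.c i x • u) + α (D.c i y • u) = α ((D.c i x + D.c i y) • u) := by
    rcases hu with hu | rfl
    · rw [add_smul, D.map_add_H hb hα (D.H.smul_mem _ hu) (D.H.smul_mem _ hu)]
    · rw [D.map_add_smul_e hb hα]
  exact smul_left_injective K hu0 (hb.1 (h1.trans h2))

include D in
theorem additive_of_map_lie (x y : R) : α (x + y) = α x + α y := by
  obtain ⟨z, hz⟩ := hb.2 (α x + α y)
  have hd : z - (x + y) ∈ D.H :=
    D.mem_of_c_eq_zero fun i ↦ by simp [D.c_of_map_eq_add hb hα hz i]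
  suffices z - (x + y) = 0 by rw [← sub_eq_zero.mp this, hz]
  refine D.separating _ hd fun i ↦ ?_
  -- Bracketing with `e i` moves the defect `z - (x + y)` into the coordinate `c i`.
  have h1 := D.c_of_map_eq_add hb hα (map_lie_of_map_eq_add hα hz (D.e i)) i
  have h2 : D.c i ⁅D.e i, z - (x + y)⁆ = 0 := by
    rw [lie_sub, lie_add, map_sub, map_add, h1, sub_self]
  rwa [D.e_lie hd, map_neg, map_smul, D.c_self, smul_eq_mul, mul_one, neg_eq_zero] at h2

end Additivity

theorem isUALieRing {K : Type u} {R : Type v} {ι : Type*} [Field K] [LieRing R] [LieAlgebra K R]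
    [Fintype ι] (D : RootDecomposition K R ι) : IsUALieRing.{v, w} R :=
  fun _ _ _ hb hα ↦ D.additive_of_map_lie hb hα

end RootDecomposition

/-! ### Replicas of an element of a semisimple Lie algebra -/

section Replica

open Module Polynomial LieAlgebra

variable {K : Type*} [Field K]

/-- Chinese remainder theorem for the generalized eigenspaces of `T`: any function on the spectrum
is realised by a polynomial in `T` acting as a scalar on each generalized eigenspace. -/
lemma exists_aeval_apply_eq_smul {V : Type*} [AddCommGroup V] [Module K V] [FiniteDimensional K V]
    (T : End K V) (f : K → K) :
    ∃ p : K[X], ∀ μ, ∀ v ∈ T.maxGenEigenspace μ, aeval T p v = f μ • v := by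
  classical
  set s : Finset K := (T.finite_hasEigenvalue).toFinset
  set n := finrank K V
  obtain ⟨p, hp⟩ := Ideal.exists_forall_sub_mem_ideal
    (I := fun μ : s ↦ Ideal.span {(X - C (μ : K)) ^ n}) (fun μ ν hμν ↦ by
      rw [Function.onFun, Ideal.isCoprime_span_singleton_iff]
      exact (pairwise_coprime_X_sub_C Subtype.val_injective hμν).pow) (fun μ ↦ C (f μ))
  refine ⟨p, fun μ v hv ↦ ?_⟩
  by_cases hμ : T.HasEigenvalue μ
  · obtain ⟨q, hq⟩ := Ideal.mem_span_singleton'.mp (hp ⟨μ, by simpa [s] using hμ⟩)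
    rw [End.maxGenEigenspace_eq_genEigenspace_finrank, End.mem_genEigenspace_nat,
      LinearMap.mem_ker] at hv
    have h1 : aeval T (p - C (f μ)) v = 0 := by
      rw [← hq, map_mul, End.mul_apply, map_pow, map_sub, aeval_X, aeval_C,
        Algebra.algebraMap_eq_smul_one, hv, map_zero]
    rwa [map_sub, aeval_C, LinearMap.sub_apply, algebraMap_end_apply, sub_eq_zero] at h1
  · have h0 : T.maxGenEigenspace μ = ⊥ := by
      by_contra h
      exact hμ (End.hasEigenvalue_of_hasGenEigenvalue (k := n)
        (by rwa [End.maxGenEigenspace_eq_genEigenspace_finrank] at h))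
    have : v = 0 := by simpa [h0] using hv
    simp [this]

variable [IsAlgClosed K] {g : Type*} [LieRing g] [LieAlgebra K g] [FiniteDimensional K g]

/-- For an additive function `f`, the operator acting by `f μ` on the generalized `μ`-eigenspace of
`ad x` is a derivation, hence inner. -/
lemma LieAlgebra.IsKilling.exists_ad_eq_aeval [LieAlgebra.IsKilling K g] (x : g) (f : K →+ K) :
    ∃ y : g, ∃ p : K[X], ad K g y = aeval (ad K g x) p ∧
      ∀ μ, ∀ v ∈ (ad K g x).maxGenEigenspace μ, ⁅y, v⁆ = f μ • v := by
  obtain ⟨p, hp⟩ := exists_aeval_apply_eq_smul (ad K g x) f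
  set D : End K g := aeval (ad K g x) p
  have htop := End.iSup_maxGenEigenspace_eq_top (ad K g x)
  have hD (a b : g) : D ⁅a, b⁆ = ⁅a, D b⁆ - ⁅b, D a⁆ := by
    have ha : a ∈ ⨆ μ, (ad K g x).maxGenEigenspace μ := htop ▸ Submodule.mem_top
    have hb : b ∈ ⨆ μ, (ad K g x).maxGenEigenspace μ := htop ▸ Submodule.mem_top
    induction ha using Submodule.iSup_induction' with
    | zero => simp
    | add a₁ a₂ _ _ h₁ h₂ =>
      simp only [add_lie, map_add, h₁, h₂, lie_add]
      abel
    | mem μ a ha =>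
      induction hb using Submodule.iSup_induction' with
      | zero => simp
      | add b₁ b₂ _ _ h₁ h₂ =>
        simp only [lie_add, map_add, h₁, h₂, add_lie]
        abel
      | mem ν b hb =>
        rw [hp _ _ (LieModule.lie_mem_maxGenEigenspace_toEnd ha hb), hp _ _ ha, hp _ _ hb,
          lie_smul, lie_smul, ← lie_skew b a, map_add]
        module
  obtain ⟨y, hy⟩ := LieDerivation.IsKilling.exists_eq_ad (R := K) (L := g) ⟨D, hD⟩
  have hy' : ad K g y = D := by
    rw [← LieDerivation.coe_ad_apply_eq_ad_apply, hy]
  refine ⟨y, p, hy', fun μ v hv ↦ ?_⟩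
  rw [← hp μ v hv, ← ad_apply K, hy']

/-- If `κ x y = 0` for all replicas `y` of `x`, then `ad x` is nilpotent: for a `ℚ`-linear
`f : K → ℚ` and the corresponding replica, applying `f` to `κ x y` yields a sum of squares of the
values of `f` at the eigenvalues of `ad x`. -/
lemma LieAlgebra.IsKilling.isNilpotent_ad_of_forall_killingForm_eq_zero [CharZero K]
    [LieAlgebra.IsKilling K g] (x : g)
    (hx : ∀ y : g, (∃ p : K[X], ad K g y = aeval (ad K g x) p) → killingForm K g x y = 0) :
    IsNilpotent (ad K g x) := by
  classical
  set T := ad K g x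
  have htop := End.iSup_maxGenEigenspace_eq_top T
  have hint := DirectSum.isInternal_submodule_of_iSupIndep_of_iSup_eq_top
    T.independent_maxGenEigenspace htop
  have hfin : {μ | T.maxGenEigenspace μ ≠ ⊥}.Finite :=
    WellFoundedGT.finite_ne_bot_of_iSupIndep T.independent_maxGenEigenspace
  have hT (μ : K) : Set.MapsTo T (T.maxGenEigenspace μ) (T.maxGenEigenspace μ) :=
    End.mapsTo_maxGenEigenspace_of_comm (Commute.refl T) μ
  have htr (μ : K) : LinearMap.trace K _ (T.restrict (hT μ)) =
      finrank K (T.maxGenEigenspace μ) * μ := by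
    have h := (LinearMap.isNilpotent_trace_of_isNilpotent
      (End.isNilpotent_restrict_maxGenEigenspace_sub_algebraMap T μ)).eq_zero
    have h2 : (T - algebraMap K (End K g) μ).restrict (End.mapsTo_maxGenEigenspace_of_comm
        (Algebra.mul_sub_algebraMap_commutes T μ) μ) =
        T.restrict (hT μ) - μ • LinearMap.id := by
      rfl
    rw [h2, map_sub, map_smul, LinearMap.trace_id, sub_eq_zero] at h
    rw [h, smul_eq_mul, mul_comm]
  have key (f : K →ₗ[ℚ] ℚ) (μ : K) (hμ : T.maxGenEigenspace μ ≠ ⊥) : f μ = 0 := by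
    obtain ⟨y, p, hyp, hy⟩ := LieAlgebra.IsKilling.exists_ad_eq_aeval x
      ((algebraMap ℚ K).toAddMonoidHom.comp f.toAddMonoidHom)
    have h0 := hx y ⟨p, hyp⟩
    rw [killingForm_apply_apply] at h0
    have hmaps (μ : K) : Set.MapsTo (T ∘ₗ ad K g y) (T.maxGenEigenspace μ)
        (T.maxGenEigenspace μ) := by
      intro v hv
      rw [LinearMap.comp_apply, ad_apply K g y, hy μ v hv, map_smul]
      exact Submodule.smul_mem _ _ (hT μ hv)
    have hr (μ : K) : (T ∘ₗ ad K g y).restrict (hmaps μ) = (f μ : K) • T.restrict (hT μ) := by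
      ext v
      change T ⁅y, (v : g)⁆ = (f μ : K) • T v
      rw [hy μ v v.2, map_smul]
      rfl
    rw [LinearMap.trace_eq_sum_trace_restrict' hint hfin hmaps] at h0
    simp only [hr, map_smul, htr] at h0
    have h1 := congrArg f h0
    rw [map_sum, map_zero] at h1
    have h2 (ν : K) : f ((f ν : K) • (finrank K (T.maxGenEigenspace ν) * ν : K)) =
        finrank K (T.maxGenEigenspace ν) * f ν ^ 2 := by
      have : (f ν : K) • (finrank K (T.maxGenEigenspace ν) * ν : K) =
          (f ν * finrank K (T.maxGenEigenspace ν) : ℚ) • ν := by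
        rw [Rat.smul_def, smul_eq_mul]
        push_cast
        ring
      rw [this, map_smul, smul_eq_mul]
      ring
    simp only [h2] at h1
    have h3 := (Finset.sum_eq_zero_iff_of_nonneg (fun _ _ ↦ by positivity)).mp h1 μ
      (by simpa using hμ)
    have h4 : finrank K (T.maxGenEigenspace μ) ≠ 0 := by
      rwa [ne_eq, Submodule.finrank_eq_zero]
    simpa [h4] using h3
  have h0 : T.maxGenEigenspace 0 = ⊤ := by
    rw [eq_top_iff, ← htop, iSup_le_iff]
    intro μ
    by_cases hμ : T.maxGenEigenspace μ = ⊥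
    · simp [hμ]
    · rw [(Module.forall_dual_apply_eq_zero_iff ℚ μ).mp fun f ↦ key f μ hμ]
  rw [Module.End.isNilpotent_iff_of_finite]
  intro v
  have hv : v ∈ T.maxGenEigenspace 0 := h0 ▸ Submodule.mem_top
  simpa [End.mem_maxGenEigenspace] using hv

end Replica

/-! ### Borel subalgebras and the Killing form -/

/-- If `X` and `W = X * Z - Z * X` are nilpotent and commute, then `X * Z` is nilpotent: modulo
`X ^ (j + 1)` the element `X * Z` acts on the right ideal generated by `X ^ j` as `-j * W`. -/
lemma isNilpotent_mul_of_commute_commutator {A : Type*} [Ring A] {X Z W : A} (hX : IsNilpotent X)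
    (hW : IsNilpotent W) (hXZ : X * Z - Z * X = W) (hXW : X * W = W * X) :
    IsNilpotent (X * Z) := by
  obtain ⟨n, hn⟩ := hX
  obtain ⟨m, hm⟩ := hW
  have hXWj (j : ℕ) : X ^ j * W = W * X ^ j := (show Commute X W from hXW).pow_left j
  have h1 (j : ℕ) : X * Z * X ^ j = X ^ (j + 1) * Z - (j : ℤ) • (X ^ j * W) := by
    induction j with
    | zero => simp
    | succ j ih =>
      have h2 : X * Z * X = X * X * Z - X * W := by rw [← hXZ]; noncomm_ring
      calc X * Z * X ^ (j + 1) = X * Z * X ^ j * X := by rw [pow_succ]; noncomm_ring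
        _ = X ^ j * (X * Z * X) - (j : ℤ) • (X ^ j * (W * X)) := by
          rw [ih, pow_succ]; noncomm_ring
        _ = _ := by
          rw [h2, ← hXW, pow_succ, pow_succ, Nat.cast_succ, add_smul, one_smul]
          noncomm_ring
  have h2 (j : ℕ) {a : A} (ha : X ^ j ∣ a) : X ^ j ∣ X * Z * a := by
    obtain ⟨c, rfl⟩ := ha
    refine ⟨X * Z * c - (j : ℤ) • (W * c), ?_⟩
    rw [← mul_assoc, h1, pow_succ]
    noncomm_ring
  have h3 (j N : ℕ) : ∃ k : ℤ, X ^ (j + 1) ∣ (X * Z) ^ N * X ^ j - k • (X ^ j * W ^ N) := by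
    induction N with
    | zero => exact ⟨1, by simp⟩
    | succ N ih =>
      obtain ⟨k, hk⟩ := ih
      refine ⟨-(j * k), ?_⟩
      have h4 : (X * Z) ^ (N + 1) * X ^ j - (-(j * k)) • (X ^ j * W ^ (N + 1)) =
          X * Z * ((X * Z) ^ N * X ^ j - k • (X ^ j * W ^ N)) +
            X ^ (j + 1) * (k • (Z * W ^ N)) := by
        have h5 : X * Z * (X ^ j * W ^ N) =
            X ^ (j + 1) * (Z * W ^ N) - (j : ℤ) • (X ^ j * W ^ (N + 1)) := by
          rw [← mul_assoc, h1, sub_mul, smul_mul_assoc, pow_succ' W, mul_assoc, mul_assoc]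
        rw [mul_sub, mul_smul_comm, h5, mul_smul_comm, pow_succ' (X * Z), smul_sub, smul_smul,
          neg_smul, mul_comm k, mul_assoc (X * Z)]
        abel
      rw [h4]
      exact dvd_add (h2 _ hk) (dvd_mul_right _ _)
  have h6 (j : ℕ) : X ^ j ∣ (X * Z) ^ (m * j) := by
    induction j with
    | zero => simp
    | succ j ih =>
      obtain ⟨c, hc⟩ := ih
      obtain ⟨k, hk⟩ := h3 j m
      rw [hm, mul_zero, smul_zero, sub_zero] at hk
      rw [mul_add, mul_one, add_comm (m * j), pow_add (X * Z), hc, ← mul_assoc]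
      exact hk.mul_right c
  exact ⟨m * n, by simpa [hn] using h6 n⟩

section Solvable

open LieAlgebra Module Polynomial

variable {K : Type*} [Field K]

lemma LieHom.isNilpotent_ad_of_injective {L L' : Type*} [LieRing L] [LieAlgebra K L] [LieRing L']
    [LieAlgebra K L'] {f : L →ₗ⁅K⁆ L'} (hf : Function.Injective f) {x : L}
    (hx : IsNilpotent (ad K L' (f x))) : IsNilpotent (ad K L x) := by
  obtain ⟨n, hn⟩ := hx
  have h (k : ℕ) (v : L) : f ((ad K L x ^ k) v) = (ad K L' (f x) ^ k) (f v) := by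
    induction k with
    | zero => simp
    | succ k ih => simp [pow_succ', ih]
  refine ⟨n, LinearMap.ext fun v ↦ hf ?_⟩
  rw [h, hn]
  simp

lemma LieAlgebra.isSolvable_of_isSolvable_derivedSeries {L : Type*} [LieRing L] [LieAlgebra K L]
    (h : IsSolvable (derivedSeries K L 1)) : IsSolvable L := by
  obtain ⟨k, hk⟩ := IsSolvable.solvable K (derivedSeries K L 1)
  rw [LieIdeal.derivedSeries_eq_bot_iff] at hk
  refine IsSolvable.mk (R := K) (k := k + 1) ?_
  rw [derivedSeries_def, derivedSeriesOfIdeal_add]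
  exact hk

lemma LieAlgebra.derivedSeries_one_le {L : Type*} [LieRing L] [LieAlgebra K L] {U : Submodule K L}
    (h : ∀ x y : L, ⁅x, y⁆ ∈ U) : (derivedSeries K L 1).toSubmodule ≤ U := by
  rw [derivedSeries_def, derivedSeriesOfIdeal_succ, derivedSeriesOfIdeal_zero,
    LieSubmodule.lieIdeal_oper_eq_linear_span', Submodule.span_le]
  rintro _ ⟨x, -, y, -, rfl⟩
  exact h x y

lemma LieSubalgebra.isSolvable_of_forall_lie_mem {g : Type*} [LieRing g] [LieAlgebra K g]
    {b c : LieSubalgebra K g} (hb : IsSolvable b) (h : ∀ x ∈ c, ∀ y ∈ c, ⁅x, y⁆ ∈ b) :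
    IsSolvable c := by
  refine LieAlgebra.isSolvable_of_isSolvable_derivedSeries (K := K) ?_
  have hD := LieAlgebra.derivedSeries_one_le (K := K) (L := c)
    (U := b.toSubmodule.comap c.subtype) fun x y ↦ h x x.2 y y.2
  let f : derivedSeries K c 1 →ₗ⁅K⁆ b :=
    { toFun := fun d ↦ ⟨d, hD d.2⟩
      map_add' := fun _ _ ↦ rfl
      map_smul' := fun _ _ ↦ rfl
      map_lie' := rfl }
  refine Function.Injective.lieAlgebra_isSolvable (f := f) fun x y hxy ↦ ?_
  exact Subtype.ext (Subtype.ext (congrArg (fun z : b ↦ (z : g)) hxy))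

/-- One direction of Cartan's criterion, for the trace form of the ambient Lie algebra. -/
lemma LieSubalgebra.isSolvable_of_killingForm_lie_eq_zero [CharZero K] {g : Type*} [LieRing g]
    [LieAlgebra K g] [FiniteDimensional K g] {c : LieSubalgebra K g}
    (h : ∀ x ∈ c, ∀ y ∈ c, ∀ z ∈ c, killingForm K g x ⁅y, z⁆ = 0) : IsSolvable c := by
  have hD (x : c) : (derivedSeries K c 1).toSubmodule ≤
      (LinearMap.ker (killingForm K g x)).comap c.subtype :=
    LieAlgebra.derivedSeries_one_le fun y z ↦ h x x.2 y y.2 z z.2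
  have h0 : LieModule.traceForm K (derivedSeries K c 1) g = 0 := by
    ext ⟨x, hx⟩ ⟨y, hy⟩
    exact hD x hy
  have hnil := (LieModule.isNilpotent_iff_forall' (R := K)).mp
    (LieModule.isNilpotent_derivedSeries_of_traceForm_eq_zero h0)
  refine LieAlgebra.isSolvable_of_isSolvable_derivedSeries (K := K) ?_
  refine LieAlgebra.isSolvable_of_isSolvable_derivedSeries (K := K) ?_
  have : LieRing.IsNilpotent (derivedSeries K (derivedSeries K c 1) 1) := by
    rw [LieAlgebra.isNilpotent_iff_forall (R := K)]
    intro x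
    refine LieHom.isNilpotent_ad_of_injective (L' := g)
      (f := (c.incl.comp (derivedSeries K c 1).incl).comp
        (derivedSeries K (derivedSeries K c 1) 1).incl) ?_ (hnil x)
    intro x y hxy
    exact Subtype.ext (Subtype.ext (Subtype.ext hxy))
  infer_instance

section Lie

variable [IsAlgClosed K] [CharZero K] {L M : Type*} [LieRing L] [LieAlgebra K L] [IsSolvable L]
  [AddCommGroup M] [Module K M] [FiniteDimensional K M] [LieRingModule L M] [LieModule K L M]

/-- Lie's theorem in a subquotient `P / N`. -/
lemma LieModule.exists_forall_lie_sub_smul_mem {N P : LieSubmodule K L M} (h : ¬ P ≤ N) :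
    ∃ v ∈ P, v ∉ N ∧ ∃ χ : L → K, ∀ x, ⁅x, v⁆ - χ x • v ∈ N := by
  let Q : LieSubmodule K L (M ⧸ N) := P.map (LieSubmodule.Quotient.mk' N)
  obtain ⟨p, hp, hpN⟩ := SetLike.not_le_iff_exists.mp h
  have : Nontrivial Q := by
    refine nontrivial_of_ne ⟨LieSubmodule.Quotient.mk' N p, LieSubmodule.mem_map_of_mem hp⟩ 0 ?_
    intro h0
    exact hpN ((LieSubmodule.Quotient.mk_eq_zero' (N := N)).mp (congrArg Subtype.val h0))
  obtain ⟨χ, hχ⟩ := LieModule.exists_nontrivial_weightSpace_of_isSolvable K L Q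
  obtain ⟨⟨⟨q, hq⟩, hqχ⟩, hq0⟩ := exists_ne (0 : LieModule.weightSpace Q χ)
  obtain ⟨v, hv, rfl⟩ := (LieSubmodule.mem_map q).mp hq
  refine ⟨v, hv, fun hvN ↦ hq0 ?_, χ, fun x ↦ ?_⟩
  · exact Subtype.ext (Subtype.ext ((LieSubmodule.Quotient.mk_eq_zero' (N := N)).mpr hvN))
  · rw [LieModule.mem_weightSpace] at hqχ
    have h1 := congrArg Subtype.val (hqχ x)
    refine (LieSubmodule.Quotient.mk_eq_zero' (N := N)).mp ?_
    exact sub_eq_zero.mpr h1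

/-- The other direction of Cartan's criterion: by Lie's theorem, `⁅y, z⁆` is strictly triangular
with respect to a flag of submodules, hence so is its product with `x`. -/
lemma LieModule.traceForm_lie_eq_zero_of_isSolvable (x y z : L) :
    LieModule.traceForm K L M x ⁅y, z⁆ = 0 := by
  set A : End K M := LieModule.toEnd K L M x ∘ₗ LieModule.toEnd K L M ⁅y, z⁆ with hA
  obtain ⟨N, -, hN⟩ := exists_maximal_ge_of_wellFoundedGT
    (fun N : LieSubmodule K L M ↦ N.toSubmodule ≤ A.maxGenEigenspace 0) ⊥ (by simp)
  have htop : (⊤ : LieSubmodule K L M) ≤ N := by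
    by_contra hcon
    obtain ⟨v, -, hvN, χ, hχ⟩ := LieModule.exists_forall_lie_sub_smul_mem hcon
    have hlie (a b : L) : ⁅a, ⁅b, v⁆⁆ - (χ a * χ b) • v ∈ N := by
      have h1 : ⁅a, ⁅b, v⁆⁆ - (χ a * χ b) • v =
          ⁅a, ⁅b, v⁆ - χ b • v⁆ + χ b • (⁅a, v⁆ - χ a • v) := by
        rw [lie_sub, lie_smul]
        module
      exact h1 ▸ add_mem (N.lie_mem (hχ b)) (N.smul_mem (χ b) (hχ a))
    have hv : A v ∈ N := by
      have h1 : ⁅⁅y, z⁆, v⁆ =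
          (⁅y, ⁅z, v⁆⁆ - (χ y * χ z) • v) - (⁅z, ⁅y, v⁆⁆ - (χ z * χ y) • v) := by
        rw [lie_lie]
        module
      have h2 : ⁅⁅y, z⁆, v⁆ ∈ N := h1 ▸ sub_mem (hlie y z) (hlie z y)
      exact N.lie_mem h2
    let N' : LieSubmodule K L M :=
      { N.toSubmodule ⊔ K ∙ v with
        lie_mem := by
          intro a m hm
          obtain ⟨n, hn, t, rfl⟩ : ∃ n ∈ N, ∃ t : K, n + t • v = m := by
            obtain ⟨n, hn, w, hw, rfl⟩ := Submodule.mem_sup.mp hm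
            obtain ⟨t, rfl⟩ := Submodule.mem_span_singleton.mp hw
            exact ⟨n, hn, t, rfl⟩
          refine Submodule.mem_sup.mpr ⟨⁅a, n⁆ + t • (⁅a, v⁆ - χ a • v),
            add_mem (N.lie_mem hn) (N.smul_mem t (hχ a)), (t * χ a) • v,
            Submodule.mem_span_singleton.mpr ⟨_, rfl⟩, ?_⟩
          rw [lie_add, lie_smul]
          module }
    have hN' : N'.toSubmodule ≤ A.maxGenEigenspace 0 := by
      refine sup_le hN.prop ?_
      rw [Submodule.span_singleton_le_iff_mem, End.mem_maxGenEigenspace]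
      obtain ⟨k, hk⟩ := (End.mem_maxGenEigenspace _ _ _).mp (hN.prop hv)
      refine ⟨k + 1, ?_⟩
      simp only [zero_smul, sub_zero] at hk ⊢
      rw [pow_succ, End.mul_apply, hk]
    have hle : N' ≤ N := hN.le_of_ge hN' fun n hn ↦ Submodule.mem_sup_left hn
    exact hvN (hle (Submodule.mem_sup_right (Submodule.mem_span_singleton_self v)))
  have hnil : _root_.IsNilpotent A := by
    rw [Module.End.isNilpotent_iff_of_finite]
    intro v
    have := hN.prop (htop (LieSubmodule.mem_top v))
    simpa [End.mem_maxGenEigenspace] using this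
  rw [LieModule.traceForm_apply_apply]
  exact (LinearMap.isNilpotent_trace_of_isNilpotent hnil).eq_zero

end Lie

end Solvable

section Borel

open LieAlgebra Module Polynomial

variable {K : Type u} [Field K] {g : Type v} [LieRing g] [LieAlgebra K g]

/-- If `y` is an eigenvector of a subalgebra `b` modulo `b`, then `b + K • y` is a subalgebra. -/
lemma LieSubalgebra.exists_sup_span_singleton (b : LieSubalgebra K g) (y : g)
    (hy : ∀ z ∈ b, ∃ t : K, ⁅z, y⁆ - t • y ∈ b) :
    ∃ c : LieSubalgebra K g, b ≤ c ∧ y ∈ c ∧ ∀ x ∈ c, ∃ z ∈ b, ∃ t : K, z + t • y = x := by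
  have hmem (x : g) : x ∈ b.toSubmodule ⊔ K ∙ y ↔ ∃ z ∈ b, ∃ t : K, z + t • y = x := by
    simp [Submodule.mem_sup, Submodule.mem_span_singleton]
  refine ⟨{ b.toSubmodule ⊔ K ∙ y with lie_mem' := ?_ }, fun z hz ↦ Submodule.mem_sup_left hz,
    Submodule.mem_sup_right (Submodule.mem_span_singleton_self y), fun x hx ↦ (hmem x).mp hx⟩
  intro x₁ x₂ h₁ h₂
  obtain ⟨z₁, hz₁, t₁, rfl⟩ := (hmem x₁).mp h₁
  obtain ⟨z₂, hz₂, t₂, rfl⟩ := (hmem x₂).mp h₂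
  obtain ⟨s₁, hs₁⟩ := hy z₁ hz₁
  obtain ⟨s₂, hs₂⟩ := hy z₂ hz₂
  refine (hmem _).mpr ⟨⁅z₁, z₂⁆ + t₂ • (⁅z₁, y⁆ - s₁ • y) - t₁ • (⁅z₂, y⁆ - s₂ • y),
    sub_mem (add_mem (b.lie_mem hz₁ hz₂) (b.smul_mem _ hs₁)) (b.smul_mem _ hs₂),
    t₂ * s₁ - t₁ * s₂, ?_⟩
  simp only [add_lie, lie_add, smul_lie, lie_smul, lie_self, smul_zero, ← lie_skew y z₂]
  module

variable {b : LieSubalgebra K g}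

/-- A Borel subalgebra is its own normalizer. -/
lemma LieSubalgebra.IsBorel.mem_of_forall_lie_mem (hb : b.IsBorel) {y : g}
    (hy : ∀ z ∈ b, ⁅z, y⁆ ∈ b) : y ∈ b := by
  obtain ⟨c, hbc, hyc, hc⟩ := b.exists_sup_span_singleton y fun z hz ↦ ⟨0, by simpa using hy z hz⟩
  refine hb.le_of_ge (LieSubalgebra.isSolvable_of_forall_lie_mem hb.prop fun x₁ h₁ x₂ h₂ ↦ ?_)
    hbc hyc
  obtain ⟨z₁, hz₁, t₁, rfl⟩ := hc x₁ h₁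
  obtain ⟨z₂, hz₂, t₂, rfl⟩ := hc x₂ h₂
  simp only [add_lie, lie_add, smul_lie, lie_smul, lie_self, smul_zero, add_zero, ← lie_skew y z₂]
  exact add_mem (add_mem (b.lie_mem hz₁ hz₂) (b.smul_mem _ (neg_mem (hy z₂ hz₂))))
    (b.smul_mem _ (hy z₁ hz₁))

lemma LieAlgebra.killingForm_lie_left (x y z : g) :
    killingForm K g ⁅x, y⁆ z = killingForm K g x ⁅y, z⁆ :=
  LieModule.traceForm_apply_lie_apply K g g x y z

lemma LieAlgebra.ad_mul_sub_mul (x y : g) :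
    ad K g x * ad K g y - ad K g y * ad K g x = ad K g ⁅x, y⁆ := by
  ext z
  simp

lemma LieAlgebra.killingForm_comm (x y : g) : killingForm K g x y = killingForm K g y x :=
  LieModule.traceForm_comm K g g x y

variable [IsAlgClosed K] [CharZero K] [FiniteDimensional K g]

lemma LieSubalgebra.killingForm_lie_eq_zero_of_isSolvable (hb : IsSolvable b) {x y z : g}
    (hx : x ∈ b) (hy : y ∈ b) (hz : z ∈ b) : killingForm K g x ⁅y, z⁆ = 0 :=
  LieModule.traceForm_lie_eq_zero_of_isSolvable (L := b) (M := g) ⟨x, hx⟩ ⟨y, hy⟩ ⟨z, hz⟩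

/-- The Killing-orthogonal complement of a Borel subalgebra `b` is contained in `b`. Otherwise Lie's
theorem gives an eigenvector `y` of `b` in the complement modulo `b`, and `b + K • y` is solvable by
Cartan's criterion. -/
lemma LieSubalgebra.IsBorel.mem_of_killingForm_eq_zero (hb : b.IsBorel) {x : g}
    (hx : ∀ z ∈ b, killingForm K g x z = 0) : x ∈ b := by
  have hsol : IsSolvable b := hb.prop
  let P : LieSubmodule K b g :=
    { (killingForm K g).orthogonal b.toSubmodule with
      lie_mem := by
        intro a y hy z hz
        have := hy ⁅z, (a : g)⁆ (b.lie_mem hz a.2)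
        change killingForm K g z ⁅(a : g), y⁆ = 0
        rw [← killingForm_lie_left]
        exact this }
  have hP (y : g) : y ∈ P ↔ ∀ z ∈ b, killingForm K g z y = 0 := Iff.rfl
  by_contra hxb
  have hPb : ¬ b.toLieSubmodule ⊔ P ≤ b.toLieSubmodule := fun h ↦ hxb <| by
    have : x ∈ P := (hP x).mpr fun z hz ↦ by rw [killingForm_comm, hx z hz]
    exact h (LieSubmodule.mem_sup _ _ _ |>.mpr ⟨0, zero_mem _, x, this, zero_add x⟩)
  obtain ⟨v, hv, hvb, χ, hχ⟩ := LieModule.exists_forall_lie_sub_smul_mem hPb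
  obtain ⟨n, hn, y, hyP, rfl⟩ := (LieSubmodule.mem_sup _ _ _).mp hv
  have hn' : n ∈ b := hn
  rw [hP] at hyP
  have hyb : y ∉ b := fun hy ↦ hvb (add_mem hn hy)
  obtain ⟨c, hbc, hyc, hc⟩ := b.exists_sup_span_singleton y fun z hz ↦ ⟨χ ⟨z, hz⟩, by
    have h1 : ⁅z, n + y⁆ - χ ⟨z, hz⟩ • (n + y) ∈ b := hχ ⟨z, hz⟩
    have h2 : ⁅z, y⁆ - χ ⟨z, hz⟩ • y =
        (⁅z, n + y⁆ - χ ⟨z, hz⟩ • (n + y)) - ⁅z, n⁆ + χ ⟨z, hz⟩ • n := by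
      rw [lie_add]
      module
    rw [h2]
    exact add_mem (sub_mem h1 (b.lie_mem hz hn')) (b.smul_mem _ hn')⟩
  refine hyb (hb.le_of_ge (LieSubalgebra.isSolvable_of_killingForm_lie_eq_zero
    fun x₁ h₁ x₂ h₂ x₃ h₃ ↦ ?_) hbc hyc)
  obtain ⟨z₁, hz₁, t₁, rfl⟩ := hc x₁ h₁
  obtain ⟨z₂, hz₂, t₂, rfl⟩ := hc x₂ h₂
  obtain ⟨z₃, hz₃, t₃, rfl⟩ := hc x₃ h₃
  have e1 {p q r : g} (hp : p ∈ b) (hq : q ∈ b) (hr : r ∈ b) : killingForm K g p ⁅q, r⁆ = 0 :=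
    b.killingForm_lie_eq_zero_of_isSolvable hsol hp hq hr
  have e2 {p q : g} (hp : p ∈ b) (hq : q ∈ b) : killingForm K g p ⁅q, y⁆ = 0 := by
    rw [← killingForm_lie_left, hyP _ (b.lie_mem hp hq)]
  have e3 {p q : g} (hp : p ∈ b) (hq : q ∈ b) : killingForm K g y ⁅p, q⁆ = 0 := by
    rw [killingForm_comm, hyP _ (b.lie_mem hp hq)]
  have e4 (p : g) : killingForm K g y ⁅p, y⁆ = 0 := by
    rw [← lie_skew, map_neg, ← killingForm_lie_left, lie_self, map_zero, LinearMap.zero_apply,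
      neg_zero]
  simp only [add_lie, lie_add, smul_lie, lie_smul, lie_self, smul_zero, ← lie_skew y z₃, map_add,
    map_smul, map_neg, LinearMap.add_apply, LinearMap.smul_apply, e1 hz₁ hz₂ hz₃, e2 hz₁ hz₂,
    e2 hz₁ hz₃, e3 hz₂ hz₃, e4, neg_zero, add_zero]

variable [LieAlgebra.IsKilling K g]

/-- The elements of the Killing-orthogonal complement of a Borel subalgebra are nilpotent, because
a Borel subalgebra contains the replicas of its elements. -/
lemma LieSubalgebra.IsBorel.isNilpotent_ad (hb : b.IsBorel) {x : g}
    (hx : ∀ z ∈ b, killingForm K g x z = 0) : IsNilpotent (ad K g x) := by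
  have hxb := hb.mem_of_killingForm_eq_zero hx
  refine LieAlgebra.IsKilling.isNilpotent_ad_of_forall_killingForm_eq_zero x fun y ⟨p, hp⟩ ↦ hx y ?_
  refine hb.mem_of_forall_lie_mem fun z hz ↦ ?_
  rw [← lie_skew, ← ad_apply K, hp]
  exact neg_mem (p.aeval_apply_smul_mem_of_le_comap (q := b.toSubmodule) hz _
    fun w hw ↦ b.lie_mem hxb hw)

omit [IsAlgClosed K] [CharZero K] [FiniteDimensional K g] [LieAlgebra.IsKilling K g] in
lemma LieAlgebra.killingForm_ad_pow (a x y : g) (n : ℕ) :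
    killingForm K g ((ad K g a ^ n) x) y = (-1) ^ n * killingForm K g x ((ad K g a ^ n) y) := by
  induction n generalizing y with
  | zero => simp
  | succ n ih =>
    rw [pow_succ', End.mul_apply, ad_apply, ← lie_skew, map_neg, LinearMap.neg_apply,
      killingForm_lie_left, ih, ← ad_apply K g a y, ← End.mul_apply, ← pow_succ, ← pow_succ']
    ring

/-- A Borel subalgebra `b` of a semisimple Lie algebra contains a Cartan subalgebra of the ambient
algebra. Let `C` be a Cartan subalgebra of `b` that is the Engel subalgebra of `a ∈ b`, and let `G`
be the Engel subalgebra of `a` in `g`. The orthogonal complement of `C` in `G` is an ideal of `C`;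
were it nonzero it would contain a nonzero central element of `C`, which turns out to be orthogonal
to `G`. Hence it vanishes, and `G = C` for dimension reasons. -/
theorem LieSubalgebra.IsBorel.exists_isCartanSubalgebra_le (hb : b.IsBorel) :
    ∃ H : LieSubalgebra K g, H.IsCartanSubalgebra ∧ H ≤ b := by
  have := IsAlgClosed.instInfinite (K := K)
  obtain ⟨a, hC⟩ := LieAlgebra.exists_isCartanSubalgebra_engel K b
  set C : LieSubalgebra K b := LieSubalgebra.engel K a
  set G : LieSubalgebra K g := LieSubalgebra.engel K (a : g)
  obtain ⟨m₁, h₁⟩ := Filter.eventually_atTop.mp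
    (LinearMap.eventually_codisjoint_ker_pow_range_pow (ad K g a))
  obtain ⟨m₂, h₂⟩ := Filter.eventually_atTop.mp
    (LinearMap.eventually_codisjoint_ker_pow_range_pow (ad K b a))
  set n := max (finrank K g) (max m₁ m₂) with hn
  have hcoe (k : ℕ) (z : b) : (((ad K b a ^ k) z : b) : g) = (ad K g a ^ k) (z : g) :=
    LieSubalgebra.coe_ad_pow K g b a z k
  have hCG (c : b) : c ∈ C ↔ (c : g) ∈ G := by
    simp only [C, G, LieSubalgebra.mem_engel_iff, ← hcoe, ZeroMemClass.coe_eq_zero]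
  have hker {x : g} (hx : x ∈ G) : (ad K g a ^ n) x = 0 := by
    obtain ⟨k, hk⟩ := (LieSubalgebra.mem_engel_iff K _ x).mp hx
    have h := End.ker_pow_le_ker_pow_finrank (ad K g a) k (LinearMap.mem_ker.mpr hk)
    exact End.pow_map_zero_of_le (le_max_left _ _) (LinearMap.mem_ker.mp h)
  -- The Fitting decompositions of `g` and `b` with respect to `ad a`.
  have hfit (x : g) : ∃ x₀ ∈ G, ∃ x₁, x₀ + (ad K g a ^ n) x₁ = x := by
    have h : x ∈ LinearMap.ker (ad K g a ^ n) ⊔ LinearMap.range (ad K g a ^ n) := by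
      rw [(h₁ n (by omega)).eq_top]
      trivial
    obtain ⟨x₀, h₀, _, ⟨x₁, rfl⟩, rfl⟩ := Submodule.mem_sup.mp h
    exact ⟨x₀, (LieSubalgebra.mem_engel_iff K _ _).mpr ⟨n, h₀⟩, x₁, rfl⟩
  have hfitb (x : b) : ∃ x₀ ∈ C, ∃ x₁, x₀ + (ad K b a ^ n) x₁ = x := by
    have h : x ∈ LinearMap.ker (ad K b a ^ n) ⊔ LinearMap.range (ad K b a ^ n) := by
      rw [(h₂ n (by omega)).eq_top]
      trivial
    obtain ⟨x₀, h₀, _, ⟨x₁, rfl⟩, rfl⟩ := Submodule.mem_sup.mp h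
    exact ⟨x₀, (LieSubalgebra.mem_engel_iff K _ _).mpr ⟨n, h₀⟩, x₁, rfl⟩
  have horth {x : g} (hx : x ∈ G) (y : g) : killingForm K g x ((ad K g a ^ n) y) = 0 := by
    have h := killingForm_ad_pow (K := K) (a : g) x y n
    rw [hker hx, map_zero, LinearMap.zero_apply, zero_eq_mul] at h
    exact h.resolve_left (pow_ne_zero _ (by simp))
  have hperp {x : g} (hx : x ∈ G) (hxC : ∀ c ∈ C, killingForm K g x (c : g) = 0) :
      ∀ z ∈ b, killingForm K g x z = 0 := by
    intro z hz
    obtain ⟨z₀, hz₀, z₁, hz₁⟩ := hfitb ⟨z, hz⟩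
    have h : (z₀ : g) + (ad K g a ^ n) (z₁ : g) = z := by
      rw [← hcoe]
      exact congrArg Subtype.val hz₁
    rw [← h, map_add, hxC z₀ hz₀, horth hx, add_zero]
  -- The orthogonal complement of `C` in `G`, as an ideal of `C`.
  let N : LieSubmodule K C C :=
    { carrier := {x | ∀ c ∈ C, killingForm K g (x : g) (c : g) = 0}
      add_mem' := fun hx hy c hc ↦ by simp [hx c hc, hy c hc]
      zero_mem' := fun c hc ↦ by simp
      smul_mem' := fun t x hx c hc ↦ by simp [hx c hc]
      lie_mem := fun {y x} hx c hc ↦ by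
        have h := hx ⁅(y : b), c⁆ (C.lie_mem y.2 hc)
        have h2 : (((⁅y, x⁆ : C) : b) : g) = -⁅((x : b) : g), ((y : b) : g)⁆ := by
          rw [lie_skew]
          rfl
        rw [h2, map_neg, LinearMap.neg_apply, killingForm_lie_left, neg_eq_zero]
        exact h }
  have hN : N = ⊥ := by
    by_contra hne
    have : Nontrivial N := (LieSubmodule.nontrivial_iff_ne_bot K C C).mpr hne
    have : LieModule.IsNilpotent C N := Function.Injective.lieModuleIsNilpotent (R := K)
      (f := (LieHom.id : C →ₗ⁅K⁆ C)) (g := (N.incl : N →ₗ[K] C))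
      (fun _ _ ↦ rfl) N.injective_incl
    have : Nontrivial (LieModule.maxTrivSubmodule K C N) :=
      LieModule.nontrivial_max_triv_of_isNilpotent K C N
    obtain ⟨⟨⟨x, hxN⟩, hxc⟩, hx0⟩ :=
      exists_ne (0 : LieModule.maxTrivSubmodule K C N)
    refine hx0 (Subtype.ext (Subtype.ext (Subtype.ext (Subtype.ext ?_))))
    change (x : g) = 0
    have hxcomm (c : b) (hc : c ∈ C) : ⁅((x : b) : g), (c : g)⁆ = 0 := by
      have h := (LieModule.mem_maxTrivSubmodule (R := K) (L := C) (M := N) _).mp hxc ⟨c, hc⟩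
      rw [← lie_skew, neg_eq_zero]
      exact congrArg (fun y : N ↦ (((y : C) : b) : g)) h
    have hxG : ((x : b) : g) ∈ G := (hCG x).mp x.2
    have hxnil := hb.isNilpotent_ad (hperp hxG hxN)
    have hxG' (z : g) (hz : z ∈ G) : killingForm K g ((x : b) : g) z = 0 := by
      -- The bracket `⁅x, z⁆` lies in `C`, so it commutes with `x`, and it is nilpotent.
      have hwG : ⁅((x : b) : g), z⁆ ∈ G := G.lie_mem hxG hz
      have hw := hperp hwG fun c hc ↦ by
        rw [← lie_skew, map_neg, LinearMap.neg_apply, killingForm_lie_left, hxcomm c hc, map_zero,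
          neg_zero]
      have hwb := hb.mem_of_killingForm_eq_zero hw
      have hcomm : ⁅((x : b) : g), ⁅((x : b) : g), z⁆⁆ = 0 := hxcomm ⟨_, hwb⟩ ((hCG _).mpr hwG)
      have hnil := isNilpotent_mul_of_commute_commutator (X := ad K g ((x : b) : g))
        (Z := ad K g z) hxnil (hb.isNilpotent_ad hw) (ad_mul_sub_mul _ _) (by
          rw [← sub_eq_zero, ad_mul_sub_mul, hcomm, map_zero])
      rw [killingForm_apply_apply]
      exact (LinearMap.isNilpotent_trace_of_isNilpotent hnil).eq_zero
    refine (LieAlgebra.IsKilling.killingForm_nondegenerate K g).1 _ fun z ↦ ?_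
    obtain ⟨z₀, hz₀, z₁, rfl⟩ := hfit z
    rw [map_add, hxG' z₀ hz₀, horth hxG, add_zero]
  let ι : C →ₗ[K] g := b.subtype ∘ₗ C.subtype
  have hι : Function.Injective ι := fun x y h ↦ Subtype.ext (Subtype.ext h)
  let ψ : G →ₗ[K] Dual K C := ι.dualMap ∘ₗ killingForm K g ∘ₗ G.subtype
  have hψ : Function.Injective ψ := by
    rw [injective_iff_map_eq_zero]
    rintro ⟨x, hx⟩ h0
    have hxC (c : b) (hc : c ∈ C) : killingForm K g x (c : g) = 0 :=
      congrArg (fun f : Dual K C ↦ f ⟨c, hc⟩) h0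
    have hxb := hb.mem_of_killingForm_eq_zero (hperp hx hxC)
    have hxN : (⟨⟨x, hxb⟩, (hCG ⟨x, hxb⟩).mpr hx⟩ : C) ∈ N := hxC
    rw [hN, LieSubmodule.mem_bot] at hxN
    exact Subtype.ext (congrArg (fun y : C ↦ ((y : b) : g)) hxN)
  have hdim : finrank K G ≤ finrank K C := by
    rw [← Subspace.dual_finrank_eq (K := K) (V := C)]
    exact LinearMap.finrank_le_finrank_of_injective hψ
  have hrange : LinearMap.range ι = G.toSubmodule := by
    refine Submodule.eq_of_le_of_finrank_le ?_ ?_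
    · rintro _ ⟨c, rfl⟩
      exact (hCG c).mp c.2
    · rwa [LinearMap.finrank_range_of_inj hι]
  have hGb : G ≤ b := fun x hx ↦ by
    obtain ⟨c, rfl⟩ : x ∈ LinearMap.range ι := hrange ▸ hx
    exact (c : b).2
  let f : G →ₗ⁅K⁆ C :=
    { toFun := fun x ↦ ⟨⟨x, hGb x.2⟩, (hCG _).mpr x.2⟩
      map_add' := fun _ _ ↦ rfl
      map_smul' := fun _ _ ↦ rfl
      map_lie' := rfl }
  have hf : Function.Injective f := fun x y h ↦
    Subtype.ext (congrArg (fun y : C ↦ ((y : b) : g)) h)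
  exact ⟨G, ⟨hf.lieAlgebra_isNilpotent, LieSubalgebra.normalizer_engel _ _⟩, hGb⟩

lemma LieSubalgebra.exists_isBorel (K : Type u) [Field K] (g : Type v) [LieRing g]
    [LieAlgebra K g] [FiniteDimensional K g] : ∃ b : LieSubalgebra K g, b.IsBorel := by
  have : Subsingleton (⊥ : LieSubalgebra K g) := LieSubalgebra.subsingleton_bot
  have : IsLieAbelian (⊥ : LieSubalgebra K g) := ⟨fun _ _ ↦ Subsingleton.elim _ _⟩
  exact exists_maximal_of_wellFoundedGT _ ⟨⊥, inferInstance⟩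

end Borel

/-! ### Parabolic subalgebras -/

section Parabolic

open LieAlgebra Module Polynomial

variable {K : Type u} [Field K] [IsAlgClosed K] [CharZero K] {g : Type v} [LieRing g]
  [LieAlgebra K g] [FiniteDimensional K g] [LieAlgebra.IsKilling K g]
  {H : LieSubalgebra K g} [H.IsCartanSubalgebra]

open LieAlgebra.IsKilling LieModule

/-- The root spaces of `±α` are lines spanned by vectors `e` and `f` whose bracket is a nonzero
element of the Cartan subalgebra and which pair nontrivially under the Killing form. -/
lemma LieAlgebra.IsKilling.exists_root_vectors {α : Weight K H g} (hα : α.IsNonZero) :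
    ∃ e f : g, e ∈ rootSpace H α ∧ e ≠ 0 ∧ ⁅e, f⁆ ∈ H ∧ ⁅e, f⁆ ≠ 0 ∧ killingForm K g f e ≠ 0 ∧
      f ∈ rootSpace H (-α) ∧ (∀ r ∈ rootSpace H α, ∃ t : K, t • e = r) ∧
      ∀ r ∈ rootSpace H (-α), ∃ t : K, t • f = r := by
  obtain ⟨h, e, f, ht, he, hf⟩ := exists_isSl2Triple_of_weight_isNonZero hα
  have h1 := ht.h_eq_coroot hα he hf
  refine ⟨e, f, he, ht.e_ne_zero, ?_, ?_, fun h0 ↦ ?_, hf, fun r hr ↦ ?_, fun r hr ↦ ?_⟩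
  · rw [ht.lie_e_f, h1]
    exact (coroot α).2
  · rw [ht.lie_e_f]
    exact ht.h_ne_zero
  · have h2 := lie_eq_killingForm_smul_of_mem_rootSpace_of_mem_rootSpace_neg he hf
    rw [killingForm_comm, h0, zero_smul, ht.lie_e_f] at h2
    exact ht.h_ne_zero h2
  · obtain ⟨t, ht'⟩ := (finrank_eq_one_iff_of_nonzero' (⟨e, he⟩ : rootSpace H α)
      (fun h ↦ ht.e_ne_zero (congrArg Subtype.val h))).mp (finrank_rootSpace_eq_one α hα) ⟨r, hr⟩
    exact ⟨t, congrArg Subtype.val ht'⟩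
  · obtain ⟨t, ht'⟩ := (finrank_eq_one_iff_of_nonzero' (⟨f, hf⟩ : rootSpace H (-α))
      (fun h ↦ ht.f_ne_zero (congrArg Subtype.val h))).mp
        (finrank_rootSpace_eq_one (-α) hα.neg) ⟨r, hr⟩
    exact ⟨t, congrArg Subtype.val ht'⟩

lemma LieAlgebra.IsKilling.exists_weight_apply_eq_one {α : Weight K H g} (hα : α.IsNonZero) :
    ∃ h : H, α h = 1 := by
  refine ⟨(2⁻¹ : K) • coroot α, ?_⟩
  rw [map_smul, root_apply_coroot hα, smul_eq_mul, inv_mul_cancel₀ two_ne_zero]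

/-- The root system is reduced, so a root is separated from every other root but its negative. -/
lemma LieAlgebra.IsKilling.exists_weight_apply_eq_one_and_eq_zero {α γ : Weight K H g}
    (hα : α.IsNonZero) (hγ : γ.IsNonZero) (h1 : γ ≠ α) (h2 : γ ≠ -α) :
    ∃ h : H, α h = 1 ∧ γ h = 0 := by
  by_contra! hcon
  obtain ⟨h₀, hh₀⟩ := exists_weight_apply_eq_one hγ
  have hker (h : H) (hh : γ h = 0) : α h = 0 := by
    by_contra h0
    refine hcon ((α h)⁻¹ • h) ?_ ?_
    · rw [map_smul, smul_eq_mul, inv_mul_cancel₀ h0]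
    · rw [map_smul, hh, smul_zero]
  have hαγ : (α : H → K) = α h₀ • (γ : H → K) := by
    ext h
    have h3 := hker (h - γ h • h₀) (by rw [map_sub, map_smul, hh₀]; simp)
    rw [map_sub, map_smul, sub_eq_zero] at h3
    rw [h3, Pi.smul_apply, smul_eq_mul, smul_eq_mul, mul_comm]
  rcases eq_neg_or_eq_of_eq_smul (H := H) γ α hα _ hαγ with h | h
  · exact h2 (by rw [h, neg_neg])
  · exact h1 h.symm

variable {b p : LieSubalgebra K g}

/-- A subalgebra containing a Borel subalgebra, hence a Cartan subalgebra `H`, is the sum of `H` and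
the root spaces it contains. Its roots separate the points of `H`: an element of `H` on which they
all vanish commutes with the Borel subalgebra `b`, so by invariance of the Killing form it maps `g`
into the orthogonal complement of `b`, which lies in `b`, so it kills the root spaces outside `p`
as well. -/
theorem LieSubalgebra.IsBorel.exists_rootDecomposition (hb : b.IsBorel) (hHb : H ≤ b)
    (hbp : b ≤ p) :
    ∃ (ι : Type (max u v)) (_ : Fintype ι), Nonempty (RootDecomposition K p ι) := by
  classical
  choose! e f heα he0 hefH hef0 hκ hfα hspan hspan' using
    fun (α : Weight K H g) (hα : α.IsNonZero) ↦ exists_root_vectors hα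
  let ι := {α : Weight K H g // α.IsNonZero ∧ e α ∈ p}
  have hHp : H ≤ p := hHb.trans hbp
  -- By invariance, the Killing form pairs `f α` to zero with every weight space but that of `α`.
  let c (α : Weight K H g) : g →ₗ[K] K := (killingForm K g (f α) (e α))⁻¹ • killingForm K g (f α)
  have hc_self {α : Weight K H g} (hα : α.IsNonZero) : c α (e α) = 1 := by
    simp [c, hκ α hα]
  have hc_zero {α : Weight K H g} (hα : α.IsNonZero) {χ : H → K} (hχ : χ ≠ α) {r : g}
      (hr : r ∈ rootSpace H χ) : c α r = 0 := by
    have h : killingForm K g (f α) r = 0 :=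
      killingForm_apply_eq_zero_of_mem_rootSpace_of_add_ne_zero K g H (hfα α hα) hr
        (fun h ↦ hχ (neg_add_eq_zero.mp h).symm)
    simp [c, h]
  have hH0 {r : g} : r ∈ H ↔ r ∈ rootSpace H (0 : H → K) := by
    rw [LieAlgebra.rootSpace_zero_eq K g H, LieSubalgebra.mem_toLieSubmodule]
  have hc_H {α : Weight K H g} (hα : α.IsNonZero) {r : g} (hr : r ∈ H) : c α r = 0 :=
    hc_zero hα (fun h ↦ hα h.symm) (hH0.mp hr)
  have hlie_H {r s : g} (hr : r ∈ H) (hs : s ∈ H) : ⁅r, s⁆ = 0 :=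
    congrArg Subtype.val (trivial_lie_zero H H ⟨r, hr⟩ ⟨s, hs⟩)
  have hlie_e {α : Weight K H g} (hα : α.IsNonZero) {r : g} (hr : r ∈ H) :
      ⁅r, e α⁆ = α ⟨r, hr⟩ • e α := lie_eq_smul_of_mem_rootSpace (heα α hα) ⟨r, hr⟩
  have hopp {α : Weight K H g} (hα : α.IsNonZero) :
      ⁅e (-α), e α⁆ ≠ 0 ∧ ⁅e (-α), e α⁆ ∈ H := by
    have hmem : e (-α) ∈ rootSpace H (-(α : H → K)) := by
      rw [← Weight.coe_neg]
      exact heα (-α) hα.neg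
    obtain ⟨t, ht⟩ := hspan' α hα _ hmem
    have ht0 : t ≠ 0 := fun h0 ↦ he0 (-α) hα.neg (by rw [← ht, h0, zero_smul])
    have h : ⁅e (-α), e α⁆ = (-t) • ⁅e α, f α⁆ := by
      rw [← ht, smul_lie, ← lie_skew, smul_neg, neg_smul]
    rw [h]
    exact ⟨smul_ne_zero (neg_ne_zero.mpr ht0) (hef0 α hα), H.smul_mem _ (hefH α hα)⟩
  -- The decomposition of `p` into weight spaces of `H`.
  let P : LieSubmodule K H g :=
    { p.toSubmodule with lie_mem := fun {h} _ hm ↦ p.lie_mem (hHp h.2) hm }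
  have hdecomp (r : g) (hr : r ∈ p) : r - ∑ α : ι, c α.1 r • e α.1 ∈ H := by
    have hrP : r ∈ (⨆ χ : Weight K H g, P ⊓ genWeightSpace g χ : LieSubmodule K H g) := by
      rw [← LieModule.eq_iSup_inf_genWeightSpace]
      exact hr
    clear hr
    induction hrP using LieSubmodule.iSup_induction' with
    | zero => simp
    | add x y hx hy ihx ihy =>
      have h : x + y - ∑ α : ι, c α.1 (x + y) • e α.1 =
          (x - ∑ α : ι, c α.1 x • e α.1) + (y - ∑ α : ι, c α.1 y • e α.1) := by
        simp only [map_add, add_smul, Finset.sum_add_distrib]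
        abel
      exact h ▸ add_mem ihx ihy
    | mem χ x hx =>
      obtain ⟨hxp, hxχ⟩ := (LieSubmodule.mem_inf _ _ _).mp hx
      by_cases hχ : χ.IsZero
      · have hxH : x ∈ H := hH0.mpr (by rwa [hχ.eq] at hxχ)
        rw [Finset.sum_eq_zero fun α _ ↦ by rw [hc_H α.2.1 hxH, zero_smul], sub_zero]
        exact hxH
      · obtain ⟨t, rfl⟩ := hspan χ hχ x hxχ
        by_cases ht : t = 0
        · simp [ht]
        have hχp : e χ ∈ p := by
          have h : t⁻¹ • t • e χ ∈ p := p.smul_mem _ hxp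
          rwa [inv_smul_smul₀ ht] at h
        rw [Finset.sum_eq_single (⟨χ, hχ, hχp⟩ : ι)]
        · rw [map_smul, hc_self hχ, smul_eq_mul, mul_one, sub_self]
          exact zero_mem H
        · intro α _ hα
          rw [hc_zero α.2.1 (fun h ↦ hα (Subtype.ext (Weight.ext_iff'.mp h).symm)) hxχ, zero_smul]
        · simp
  have hsep (h : g) (hh : h ∈ H) (h0 : ∀ α : ι, α.1 ⟨h, hh⟩ = 0) : h = 0 := by
    have hcomm (z : g) (hz : z ∈ p) : ⁅h, z⁆ = 0 := by
      rw [← sub_add_cancel z (∑ α : ι, c α.1 z • e α.1), lie_add, hlie_H hh (hdecomp z hz),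
        zero_add, lie_sum]
      exact Finset.sum_eq_zero fun α _ ↦ by
        rw [lie_smul, hlie_e α.2.1 hh, h0 α, zero_smul, smul_zero]
    have hall (α : Weight K H g) : α ⟨h, hh⟩ = 0 := by
      by_contra hα0
      have hα : α.IsNonZero := fun hz ↦ hα0 (congrFun hz.eq _)
      have hmem : ⁅h, e α⁆ ∈ b := hb.mem_of_killingForm_eq_zero fun z hz ↦ by
        rw [← lie_skew, map_neg, LinearMap.neg_apply, killingForm_lie_left, hcomm z (hbp hz),
          map_zero, neg_zero]
      rw [hlie_e hα hh] at hmem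
      have hαp : e α ∈ p := by
        have h1 := p.smul_mem (α ⟨h, hh⟩)⁻¹ (hbp hmem)
        rwa [inv_smul_smul₀ hα0] at h1
      exact hα0 (h0 ⟨α, hα, hαp⟩)
    have h1 : (⟨h, hh⟩ : H) ∈ ⨅ α : Weight K H g, α.ker := (Submodule.mem_iInf _).mpr hall
    rw [iInf_ker_weight_eq_bot, Submodule.mem_bot] at h1
    exact congrArg Subtype.val h1
  -- The weight `α` of `H`, extended linearly to `p`.
  let β (α : ι) : p →ₗ[K] K := -(c α.1 ∘ₗ ad K g (e α.1) ∘ₗ p.subtype)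
  have hβ (α : ι) {r : p} (hr : (r : g) ∈ H) : β α r = α.1 ⟨r, hr⟩ := by
    change -(c α.1 ⁅e α.1, (r : g)⁆) = _
    rw [← map_neg, lie_skew, hlie_e α.2.1 hr, map_smul, hc_self α.2.1, smul_eq_mul, mul_one]
  have hisol (α γ : ι) (h1 : γ ≠ α) (h2 : γ.1 ≠ -α.1) :
      ∃ h ∈ H.toSubmodule.comap p.subtype, β α h = 1 ∧ β γ h = 0 := by
    obtain ⟨h, hα, hγ⟩ := exists_weight_apply_eq_one_and_eq_zero α.2.1 γ.2.1
      (fun h ↦ h1 (Subtype.ext h)) h2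
    refine ⟨⟨h, hHp h.2⟩, h.2, ?_, ?_⟩
    · rw [hβ α (r := ⟨h, hHp h.2⟩) h.2]
      exact hα
    · rw [hβ γ (r := ⟨h, hHp h.2⟩) h.2]
      exact hγ
  refine ⟨ι, inferInstance, ⟨{
    H := H.toSubmodule.comap p.subtype
    e := fun α ↦ ⟨e α.1, α.2.2⟩
    c := fun α ↦ c α.1 ∘ₗ p.subtype
    β := β
    lie_H := fun h hh h' hh' ↦ Subtype.ext (hlie_H hh hh')
    lie_e := fun h hh α ↦ Subtype.ext (by
      rw [hβ α hh]
      exact hlie_e α.2.1 hh)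
    c_self := fun α ↦ hc_self α.2.1
    c_ne := fun α γ hαγ ↦ hc_zero α.2.1
      (fun h ↦ hαγ (Subtype.ext (Weight.ext_iff'.mp h).symm)) (heα γ.1 γ.2.1)
    c_H := fun α h hh ↦ hc_H α.2.1 hh
    sub_sum_mem := fun r ↦ by
      have h := hdecomp r r.2
      change p.subtype (r - _) ∈ H
      rw [map_sub, map_sum]
      exact h
    separating := fun h hh h0 ↦ Subtype.ext (hsep h hh fun α ↦ by rw [← hβ α hh, h0 α])
    exists_one := fun α ↦ ?_
    isolate := fun α ↦ ?_ }⟩⟩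
  · obtain ⟨h, h1⟩ := exists_weight_apply_eq_one α.2.1
    exact ⟨⟨h, hHp h.2⟩, h.2, (hβ α (r := ⟨h, hHp h.2⟩) h.2).trans h1⟩
  · by_cases hneg : e (-α.1) ∈ p
    · obtain ⟨hne, hmem⟩ := hopp α.2.1
      exact ⟨⟨-α.1, α.2.1.neg, hneg⟩, Or.inr ⟨fun h ↦ hne (congrArg Subtype.val h), hmem⟩,
        fun γ h1 h2 ↦ hisol α γ h1 fun h ↦ h2 (Subtype.ext h)⟩
    · exact ⟨α, Or.inl rfl, fun γ h1 _ ↦ hisol α γ h1 fun h ↦ hneg (h ▸ γ.2.2)⟩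

theorem LieSubalgebra.IsParabolic.isUALieRing (hp : p.IsParabolic) : IsUALieRing.{v, w} p := by
  obtain ⟨b, hb, hbp⟩ := hp
  obtain ⟨H, hH, hHb⟩ := hb.exists_isCartanSubalgebra_le
  obtain ⟨ι, _, ⟨D⟩⟩ := hb.exists_rootDecomposition hHb hbp
  exact D.isUALieRing

end Parabolic

lemma IsUALieRing.of_lieEquiv {K : Type u} [Field K] {L L' : Type v} [LieRing L] [LieAlgebra K L]
    [LieRing L'] [LieAlgebra K L'] (e : L ≃ₗ⁅K⁆ L') (h : IsUALieRing.{v, w} L) :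
    IsUALieRing.{v, w} L' := by
  intro S _ α hb hα x y
  have h1 := h S (α ∘ e) (hb.comp e.bijective)
    (fun a b ↦ (congrArg α (LieEquiv.map_lie e a b)).trans (hα _ _)) (e.symm x) (e.symm y)
  simpa using h1

theorem mainTheorem2 (K : Type u) [Field K] [IsAlgClosed K] [CharZero K]
    (g : Type v) [LieRing g] [LieAlgebra K g] [FiniteDimensional K g]
    [LieAlgebra.IsSemisimple K g] :
    IsUALieRing.{v, w} g ∧
      ∀ p : LieSubalgebra K g, p.IsParabolic → IsUALieRing.{v, w} p := by
  refine ⟨?_, fun p hp ↦ hp.isUALieRing⟩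
  obtain ⟨b, hb⟩ := LieSubalgebra.exists_isBorel K g
  have htop : (⊤ : LieSubalgebra K g).IsParabolic := ⟨b, hb, le_top⟩
  exact htop.isUALieRing.of_lieEquiv LieSubalgebra.topEquiv
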